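/- Let $G$ be a group, $\{H_\lambda\}_{\lambda\in\Lambda}$ a finite family of subgroups of $G$, and $X\subseteq G$ a (possibly infinite) generating set. Cayley graphs $\Gamma(G,S)$ carry the path metric $d_S$, with $|g|_S=d_S(1,g)$; if $S$ does not generate $G$, then $d_S(g,h)=\infty$ whenever $g^{-1}h\notin\langle S\rangle$; generating sets are symmetrized (letters may be used with exponent $\pm1$). Let $\mathcal H=\bigsqcup_{\lambda\in\Lambda}H_\lambda$, and let $\Gamma(G,X\sqcup\mathcal H)$ be the Cayley graph with edges labelled by letters of the disjoint union $X\sqcup\mathcal H$ (multiple edges allowed). For $h,k\in H_\lambda$, let $\widehat d_\lambda(h,k)\in[0,\infty]$ be the length of a shortest path from $h$ to $k$ in $\Gamma(G,X\sqcup\mathcal H)$ that contains no edge of the subgraph $\Gamma(H_\lambda,H_\lambda)$, i.e. no edge with endpoints in $H_\lambda$ and label in the copy of $H_\lambda$ in $\mathcal H$ ($\widehat d_\lambda(h,k)=\infty$ if there is no such path). Suppose that: (a) $\Gamma(G,X)$ is hyperbolic, i.e. for some $\delta$ each side of every geodesic triangle lies in the union of the $\delta$-neighborhoods of the other two sides;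 (b) every $H_\lambda$ is quasi-convex in $\Gamma(G,X)$, i.e. for some $\sigma$ every geodesic in $\Gamma(G,X)$ joining two elements of $H_\lambda$ lies in the $\sigma$-neighborhood of $H_\lambda$; (c) $\{H_\lambda\}_{\lambda\in\Lambda}$ is geometrically separated in $\Gamma(G,X)$, i.e. for all $\varepsilon\ge 0$ and every $x$ there is $R>0$ such that, whenever $g\in G$ and $\lambda,\mu\in\Lambda$ satisfy $\operatorname{diam}\bigl(H_\mu(x)\cap(gH_\lambda(x))^{+\varepsilon}\bigr)\ge R$, one has $\lambda=\mu$ and $g\in H_\lambda$. Here $H_\lambda(x)$ is the $H_\lambda$-orbit of $x$ and $S^{+\varepsilon}$ the $\varepsilon$-neighborhood of $S$. Then the Cayley graph $\Gamma(G,X\sqcup\mathcal H)$ is hyperbolic, and there exists $C>0$ such that for every $\lambda\in\Lambda$ the metrics $\widehat d_\lambda$ and $d_{\Omega_\lambda}$ on $H_\lambda$, where $\Omega_\lambda=\{h\in H_\lambda : |h|_X\le C\}$, are bi-Lipschitz equivalent: they are finite on the same pairs, and the ratios $\widehat d_\lambda/d_{\Omega_\lambda}$ and $d_{\Omega_\lambda}/\widehat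 d_\lambda$ are uniformly bounded on pairs of distinct points at finite distance. In particular, if every $H_\lambda$ is locally finite with respect to $d_X$ (balls of finite radius in $(H_\lambda,d_X)$ are finite), then $\{H_\lambda\}_{\lambda\in\Lambda}$ is hyperbolically embedded in $G$ with respect to $X$; that is, $G$ is generated by $X\sqcup\mathcal H$, the graph $\Gamma(G,X\sqcup\mathcal H)$ is hyperbolic, and every $(H_\lambda,\widehat d_\lambda)$ is locally finite. -/

import Mathlib

open scoped Pointwise

namespace HypEmb

universe u v

/-! ### Hyperbolic graphs, quasi-convex subsets, geometric separation

A Cayley graph `Γ(G, S)` is represented by `SimpleGraph.mulCayley S`, in which `u ≠ v` are adjacent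
iff `v = u * s` or `u = v * s` for some `s ∈ S` (so `S` is implicitly replaced by `S ∪ S⁻¹`).
Its extended path metric `SimpleGraph.edist` is the word metric `d_S` (with value `⊤` on pairs
`g, h` with `g⁻¹ * h` outside the subgroup generated by `S`). -/

section Graphs

variable {V : Type u}

/-- A (combinatorial) path is geodesic if its length is the distance between its endpoints. -/
def IsGeodesic (Γ : SimpleGraph V) {x y : V} (p : Γ.Walk x y) : Prop :=
  (p.length : ℕ∞) = Γ.edist x y

/-- A graph is hyperbolic if it is connected and, for some `δ`, each side of every geodesic
triangle lies in the union of the `δ`-neighborhoods of the other two sides. (Permuting the three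
sides cyclically gives the condition for each side.) -/
def IsHyperbolic (Γ : SimpleGraph V) : Prop :=
  Γ.Connected ∧ ∃ δ : ℕ, ∀ (x y z : V) (p : Γ.Walk x y) (q : Γ.Walk y z) (r : Γ.Walk z x),
    IsGeodesic Γ p → IsGeodesic Γ q → IsGeodesic Γ r →
      ∀ a ∈ p.support, ∃ b, (b ∈ q.support ∨ b ∈ r.support) ∧ Γ.edist a b ≤ (δ : ℕ∞)

/-- A set `S` of vertices is quasi-convex if, for some `σ`, every geodesic between two elements of
`S` lies in the `σ`-neighborhood of `S`. -/
def IsQuasiConvex (Γ : SimpleGraph V) (S : Set V) : Prop :=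
  ∃ σ : ℕ, ∀ s ∈ S, ∀ t ∈ S, ∀ p : Γ.Walk s t, IsGeodesic Γ p →
    ∀ a ∈ p.support, ∃ b ∈ S, Γ.edist a b ≤ (σ : ℕ∞)

end Graphs

section Metrics

variable {V : Type u}

/-- The `ε`-neighborhood `S^{+ε}` with respect to `d`. -/
def nbhd (d : V → V → ℕ∞) (S : Set V) (ε : ℕ) : Set V :=
  {a | ∃ b ∈ S, d a b ≤ (ε : ℕ∞)}

/-- The diameter of `S` with respect to `d`. -/
noncomputable def diam (d : V → V → ℕ∞) (S : Set V) : ℕ∞ :=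
  ⨆ a ∈ S, ⨆ b ∈ S, d a b

/-- `d` is locally finite: every ball of finite radius is finite. -/
def IsLocallyFinite (d : V → V → ℕ∞) : Prop :=
  ∀ (a : V) (n : ℕ), {b | d a b ≤ (n : ℕ∞)}.Finite

/-- Bi-Lipschitz equivalence of metrics which may take the value `⊤`: they are finite on the same
pairs, and both ratios are uniformly bounded on pairs of distinct points at finite distance. -/
def BiLipschitzEquiv (d₁ d₂ : V → V → ℕ∞) : Prop :=
  (∀ a b, d₁ a b ≠ ⊤ ↔ d₂ a b ≠ ⊤) ∧
    ∃ K : ℕ, ∀ a b, a ≠ b → d₁ a b ≠ ⊤ →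
      d₁ a b ≤ (K : ℕ∞) * d₂ a b ∧ d₂ a b ≤ (K : ℕ∞) * d₁ a b

/-- A family of subgroups `H` of a group `G` acting on a space with metric `d` is geometrically
separated if for all `ε ≥ 0` and all points `x` there is `R > 0` such that
`diam (H_j(x) ∩ (g H_i(x))^{+ε}) ≥ R` implies `i = j` and `g ∈ H_i`. -/
def GeometricallySeparated {G : Type*} [Group G] [MulAction G V] {Λ : Type v}
    (d : V → V → ℕ∞) (H : Λ → Subgroup G) : Prop :=
  ∀ (ε : ℕ) (x : V), ∃ R : ℕ, 0 < R ∧ ∀ (g : G) (i j : Λ),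
    (R : ℕ∞) ≤ diam d (MulAction.orbit (H j) x ∩ nbhd d (g • MulAction.orbit (H i) x) ε) →
      i = j ∧ g ∈ H i

end Metrics

/-! ### The Cayley graph `Γ(G, X ⊔ ℋ)` and relative metrics -/

section Relative

variable {G : Type u} [Group G] {Λ : Type v} (X : Set G) (H : Λ → Subgroup G)

/-- The word metric `d_S` on `G`. -/
noncomputable def wordDist (S : Set G) (g h : G) : ℕ∞ :=
  (SimpleGraph.mulCayley S).edist g h

/-- The word length `|g|_S`. -/
noncomputable def wordLength (S : Set G) (g : G) : ℕ∞ := wordDist S 1 g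

/-- The alphabet `X ⊔ ℋ`, where `ℋ` is the disjoint union of the subgroups `H_i`. -/
abbrev Letter : Type (max u v) := X ⊕ (Σ i : Λ, H i)

variable {X H}

/-- The element of `G` represented by a letter. -/
def Letter.toGroup : Letter X H → G
  | Sum.inl x => (x : G)
  | Sum.inr s => (s.2 : G)

variable (X H)

/-- The subset of `G` represented by the alphabet `X ⊔ ℋ`. -/
def relGenerators : Set G := Set.range (Letter.toGroup (X := X) (H := H))

/-- The underlying simple graph of `Γ(G, X ⊔ ℋ)`. It has the same vertices and the same path metric
as the graph with labelled multiple edges, whose labels matter only for admissibility of paths. -/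
def relCayley : SimpleGraph G := SimpleGraph.mulCayley (relGenerators X H)

/-- An oriented step in `Γ(G, X ⊔ ℋ)`: from a vertex `g`, the step `(a, true)` runs along the edge
labelled `a` from `g` to `g * a`, and `(a, false)` runs backwards along the edge labelled `a` from
`g * a⁻¹` to `g`. -/
abbrev Step : Type (max u v) := Letter X H × Bool

variable {X H}

/-- The element of `G` by which a step multiplies its initial vertex on the right. -/
def Step.toGroup : Step X H → G
  | (a, true) => a.toGroup
  | (a, false) => a.toGroup⁻¹

/-- The edge traversed by the step `s` from the vertex `g` belongs to `Γ(H_i, H_i)`: its label is a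
letter from the copy of `H_i` in `X ⊔ ℋ`, and its endpoints lie in `H_i`. -/
def EdgeIn (i : Λ) (g : G) (s : Step X H) : Prop :=
  (∃ h : H i, s.1 = Sum.inr ⟨i, h⟩) ∧ g ∈ H i ∧ g * s.toGroup ∈ H i

/-- The path in `Γ(G, X ⊔ ℋ)` starting at `g`, given as a list of steps, contains no edge of
`Γ(H_i, H_i)`. -/
def Avoids (i : Λ) : G → List (Step X H) → Prop
  | _, [] => True
  | g, s :: w => ¬ EdgeIn i g s ∧ Avoids i (g * s.toGroup) w

/-- The terminal vertex of the path that starts at `g` and follows the steps in `w`. -/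
def pathEnd (g : G) (w : List (Step X H)) : G := g * (w.map Step.toGroup).prod

variable (X H)

/-- The relative metric on `H_i`: the length of a shortest admissible path from `h` to `k` in
`Γ(G, X ⊔ ℋ)`, or `⊤` if there is none. -/
noncomputable def relDist (i : Λ) (h k : H i) : ℕ∞ :=
  ⨅ w : {w : List (Step X H) // pathEnd (h : G) w = k ∧ Avoids i (h : G) w}, (w.1.length : ℕ∞)

/-- The family `H` is hyperbolically embedded in `G` with respect to `X`. -/
def HyperbolicallyEmbedded : Prop :=
  (Subgroup.closure (relGenerators X H) = ⊤ ∧ IsHyperbolic (relCayley X H)) ∧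
    ∀ i, IsLocallyFinite (relDist X H i)

/-- The set `Ω_i = {h ∈ H_i | |h|_X ≤ C}`. -/
def Omega (C : ℕ) (i : Λ) : Set G := {h | h ∈ H i ∧ wordLength X h ≤ (C : ℕ∞)}

end Relative

end HypEmb

/-! Write Γ for Γ(G, X) and Γ' for Γ(G, X ⊔ ℋ). Hyperbolicity of Γ' follows the "guessing geodesics"
scheme: Γ-geodesics serve as guesses for Γ'-geodesics. Their triangles are δ-thin already in Γ,
hence in Γ'. If x, y are adjacent in Γ', they are adjacent in Γ or lie in one coset gH_i; by
quasi-convexity the guess from x to y then stays within σ of this coset, which has diameter at most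
1 in Γ'. These two facts (`IsGuess`) force guesses and Γ'-geodesics with the same endpoints to be
uniformly close (`IsGuess.interval_near_geodesic`, `IsGuess.geodesic_near_interval`), so thinness
passes to Γ'.

The lower bound on the relative metric comes from nearest point projection to H_i in Γ. An edge
labelled by X moves the projection a bounded amount (`IsNearest.dist_le_of_dist_le_one`). So does an
edge inside a coset gH_j other than H_i itself: if the projections of its endpoints were far apart,
both would be close to gH_j, against geometric separation (`exists_dist_nearest_le_of_coset`). Hence
an admissible path of length n projects to n jumps by elements of Ω_i
(`exists_wordDist_Omega_le_relDist`). Conversely, a path labelled by X is always admissible, so the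
relative metric is at most d_X, which is at most C times the Ω_i-metric. Local finiteness of d_X
makes Ω_i finite, and the Ω_i-balls contain the balls of the relative metric. -/

namespace HypEmb

/-! ### Intervals and thin triangles -/

section Interval

variable {V : Type*} {Γ : SimpleGraph V} {x y z w : V}

/-- The union of all geodesics from `x` to `y`. -/
def interval (Γ : SimpleGraph V) (x y : V) : Set V :=
  {w | Γ.dist x w + Γ.dist w y = Γ.dist x y}

theorem mem_interval : w ∈ interval Γ x y ↔ Γ.dist x w + Γ.dist w y = Γ.dist x y := Iff.rfl

theorem interval_comm (Γ : SimpleGraph V) (x y : V) : interval Γ x y = interval Γ y x := by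
  ext w
  simp only [mem_interval, Γ.dist_comm (u := y), Γ.dist_comm (v := x)]
  omega

theorem left_mem_interval : x ∈ interval Γ x y := by simp [mem_interval]

theorem right_mem_interval : y ∈ interval Γ x y := by simp [mem_interval]

theorem IsGeodesic.length_eq {p : Γ.Walk x y} (hp : IsGeodesic Γ p) : p.length = Γ.dist x y := by
  have h : (p.length : ℕ∞) = Γ.edist x y := hp
  rw [← SimpleGraph.Reachable.coe_dist_eq_edist ⟨p⟩] at h
  exact_mod_cast h

theorem isGeodesic_of_length_eq {p : Γ.Walk x y} (hp : p.length = Γ.dist x y) :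
    IsGeodesic Γ p := by
  have h : ((Γ.dist x y : ℕ) : ℕ∞) = Γ.edist x y :=
    SimpleGraph.Reachable.coe_dist_eq_edist ⟨p⟩
  rw [IsGeodesic, hp, h]

theorem edist_le_coe_iff (hc : Γ.Connected) {n : ℕ} :
    Γ.edist x y ≤ (n : ℕ∞) ↔ Γ.dist x y ≤ n := by
  rw [← (hc x y).coe_dist_eq_edist]
  exact Nat.cast_le

theorem IsGeodesic.mem_interval (hc : Γ.Connected) {p : Γ.Walk x y} (hp : IsGeodesic Γ p)
    (hw : w ∈ p.support) : w ∈ interval Γ x y := by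
  classical
  have h₁ := Γ.dist_le (p.takeUntil w hw)
  have h₂ := Γ.dist_le (p.dropUntil w hw)
  have h₃ := congrArg SimpleGraph.Walk.length (p.take_spec hw)
  rw [SimpleGraph.Walk.length_append, hp.length_eq] at h₃
  have h₄ := hc.dist_triangle (u := x) (v := w) (w := y)
  rw [HypEmb.mem_interval]
  omega

theorem exists_isGeodesic_of_mem_interval (hc : Γ.Connected) (hw : w ∈ interval Γ x y) :
    ∃ p : Γ.Walk x y, IsGeodesic Γ p ∧ w ∈ p.support := by
  obtain ⟨p, hp⟩ := hc.exists_walk_length_eq_dist x w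
  obtain ⟨q, hq⟩ := hc.exists_walk_length_eq_dist w y
  refine ⟨p.append q, isGeodesic_of_length_eq ?_, ?_⟩
  · rw [SimpleGraph.Walk.length_append, hp, hq, hw]
  · simp [SimpleGraph.Walk.mem_support_append_iff]

/-- Geodesic triangles of `Γ` are `δ`-thin, formulated with intervals. -/
def IsThin (Γ : SimpleGraph V) (δ : ℕ) : Prop :=
  ∀ x y z, ∀ w ∈ interval Γ x y,
    ∃ b, (b ∈ interval Γ y z ∨ b ∈ interval Γ z x) ∧ Γ.dist w b ≤ δ

theorem IsHyperbolic.exists_isThin (h : IsHyperbolic Γ) : ∃ δ, IsThin Γ δ := by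
  obtain ⟨hc, δ, hδ⟩ := h
  refine ⟨δ, fun x y z w hw => ?_⟩
  obtain ⟨p, hp, hwp⟩ := exists_isGeodesic_of_mem_interval hc hw
  obtain ⟨q, hq⟩ := hc.exists_walk_length_eq_dist y z
  obtain ⟨r, hr⟩ := hc.exists_walk_length_eq_dist z x
  have hq := isGeodesic_of_length_eq hq
  have hr := isGeodesic_of_length_eq hr
  obtain ⟨b, hb, hwb⟩ := hδ x y z p q r hp hq hr w hwp
  exact ⟨b, hb.imp (hq.mem_interval hc) (hr.mem_interval hc), (edist_le_coe_iff hc).1 hwb⟩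

theorem IsGeodesic.dist_getVert (hc : Γ.Connected) {p : Γ.Walk x y} (hp : IsGeodesic Γ p)
    {i j : ℕ} (hij : i ≤ j) (hj : j ≤ p.length) :
    Γ.dist (p.getVert i) (p.getVert j) = j - i := by
  have key : ∀ {a b : ℕ}, a ≤ b → Γ.dist (p.getVert a) (p.getVert b) ≤ b - a := by
    intro a b hab
    have he : (p.drop a).getVert (b - a) = p.getVert b := by
      rw [SimpleGraph.Walk.drop_getVert, Nat.add_sub_cancel' hab]
    rw [← he]
    exact (Γ.dist_le ((p.drop a).take (b - a))).trans (by simp)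
  have h₁ := key (Nat.zero_le i)
  have h₂ := key hij
  have h₃ := key hj
  rw [p.getVert_zero] at h₁
  rw [p.getVert_length] at h₃
  have h₄ := hp.length_eq
  have h₅ := hc.dist_triangle (u := x) (v := p.getVert i) (w := y)
  have h₆ := hc.dist_triangle (u := p.getVert i) (v := p.getVert j) (w := y)
  omega

/-- Valid for every index because `getVert` is constant past the end; a walk thus becomes an
infinite 1-Lipschitz sequence, as `IsGuess.near_path` requires. -/
theorem dist_getVert_succ_le (p : Γ.Walk x y) (i : ℕ) :
    Γ.dist (p.getVert i) (p.getVert (i + 1)) ≤ 1 := by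
  rcases lt_or_ge i p.length with h | h
  · exact (SimpleGraph.dist_eq_one_iff_adj.2 (p.adj_getVert_succ h)).le
  · rw [p.getVert_of_length_le h, p.getVert_of_length_le (h.trans i.le_succ)]
    simp

theorem exists_adj_mem_interval (hc : Γ.Connected) (hne : x ≠ y) :
    ∃ z, Γ.dist x z = 1 ∧ Γ.dist z y + 1 = Γ.dist x y := by
  obtain ⟨p, hp⟩ := hc.exists_walk_length_eq_dist x y
  have hpos := hc.pos_dist_of_ne hne
  have hg := isGeodesic_of_length_eq hp
  have h₁ := hg.dist_getVert hc (Nat.zero_le 1) (by omega)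
  have h₂ := hg.dist_getVert hc (show 1 ≤ p.length by omega) le_rfl
  rw [p.getVert_zero] at h₁
  rw [p.getVert_length] at h₂
  exact ⟨p.getVert 1, h₁, by omega⟩

end Interval

/-! ### Guessing geodesics -/

section Guessing

variable {V : Type*} {Γ Γ' : SimpleGraph V} {δ D : ℕ}

theorem exists_linear_lt_two_pow (a b : ℕ) : ∃ N, ∀ n ≥ N, a * n + b < 2 ^ n := by
  have h₁ : Filter.Tendsto (fun n : ℕ => (n : ℝ) ^ 1 / 2 ^ n) Filter.atTop (nhds 0) :=
    tendsto_pow_const_div_const_pow_of_one_lt 1 one_lt_two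
  have h₂ : Filter.Tendsto (fun n : ℕ => (n : ℝ) ^ 0 / 2 ^ n) Filter.atTop (nhds 0) :=
    tendsto_pow_const_div_const_pow_of_one_lt 0 one_lt_two
  have h := (h₁.const_mul (a : ℝ)).add (h₂.const_mul (b : ℝ))
  simp only [mul_zero, add_zero] at h
  obtain ⟨N, hN⟩ := Filter.eventually_atTop.1 (h.eventually (gt_mem_nhds one_pos))
  refine ⟨N, fun n hn => ?_⟩
  have h₃ := hN n hn
  have hp : (0 : ℝ) < 2 ^ n := by positivity
  rw [pow_one, pow_zero, ← mul_div_assoc, ← mul_div_assoc, ← add_div, div_lt_one hp, mul_one] at h₃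
  exact_mod_cast h₃

/-- The intervals of `Γ` satisfy the hypotheses of the guessing geodesics criterion in `Γ'`. -/
structure IsGuess (Γ Γ' : SimpleGraph V) (δ D : ℕ) : Prop where
  connected : Γ.Connected
  connected' : Γ'.Connected
  dist_le : ∀ x y, Γ'.dist x y ≤ Γ.dist x y
  thin : IsThin Γ δ
  base : ∀ x y, Γ'.dist x y ≤ 1 → ∀ w ∈ interval Γ x y, Γ'.dist w x ≤ D

/-- Bisection: each halving of the path costs one thin triangle, so the error is logarithmic in the
length of the path. -/
theorem IsGuess.near_path (h : IsGuess Γ Γ' δ D) {f : ℕ → V}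
    (hf : ∀ m, Γ'.dist (f m) (f (m + 1)) ≤ 1) (k : ℕ) :
    ∀ i j, i ≤ j → j ≤ i + 2 ^ k → ∀ w ∈ interval Γ (f i) (f j),
      ∃ m, i ≤ m ∧ m ≤ j ∧ Γ'.dist w (f m) ≤ δ * k + D := by
  induction k with
  | zero =>
    intro i j hij hj w hw
    refine ⟨i, le_rfl, hij, ?_⟩
    have h₁ : Γ'.dist (f i) (f j) ≤ 1 := by
      obtain rfl | rfl : j = i ∨ j = i + 1 := by omega
      · simp
      · exact hf i
    have := h.base _ _ h₁ w hw
    omega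
  | succ k ih =>
    intro i j hij hj w hw
    rw [pow_succ] at hj
    by_cases hs : j ≤ i + 2 ^ k
    · obtain ⟨m, h₁, h₂, h₃⟩ := ih i j hij hs w hw
      exact ⟨m, h₁, h₂, h₃.trans (by gcongr; omega)⟩
    · obtain ⟨b, hb, hwb⟩ := h.thin _ _ (f (i + 2 ^ k)) w hw
      have hwb' := (h.dist_le w b).trans hwb
      rcases hb with hb | hb
      · rw [interval_comm] at hb
        obtain ⟨m, h₁, h₂, h₃⟩ := ih (i + 2 ^ k) j (by omega) (by omega) b hb
        have := h.connected'.dist_triangle (u := w) (v := b) (w := f m)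
        exact ⟨m, by omega, h₂, by rw [mul_add]; omega⟩
      · rw [interval_comm] at hb
        obtain ⟨m, h₁, h₂, h₃⟩ := ih i (i + 2 ^ k) (by omega) le_rfl b hb
        have := h.connected'.dist_triangle (u := w) (v := b) (w := f m)
        exact ⟨m, h₁, by omega, by rw [mul_add]; omega⟩

theorem IsGuess.near_geodesic_segment (h : IsGuess Γ Γ' δ D) {x y : V} {p : Γ'.Walk x y}
    (hp : IsGeodesic Γ' p) {k : ℕ} {a b w : V} (ha : a ∈ p.support) (hb : b ∈ p.support)
    (hab : Γ'.dist a b ≤ 2 ^ k) (hw : w ∈ interval Γ a b) :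
    ∃ m ∈ p.support, Γ'.dist a m + Γ'.dist m b = Γ'.dist a b ∧ Γ'.dist w m ≤ δ * k + D := by
  obtain ⟨i, rfl, hi⟩ := SimpleGraph.Walk.mem_support_iff_exists_getVert.1 ha
  obtain ⟨j, rfl, hj⟩ := SimpleGraph.Walk.mem_support_iff_exists_getVert.1 hb
  rcases le_total i j with hij | hij
  · have h₀ := hp.dist_getVert h.connected' hij hj
    obtain ⟨m, h₁, h₂, h₃⟩ := h.near_path (dist_getVert_succ_le p) k i j hij (by omega) w hw
    refine ⟨p.getVert m, p.getVert_mem_support m, ?_, h₃⟩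
    rw [h₀, hp.dist_getVert h.connected' h₁ (by omega), hp.dist_getVert h.connected' h₂ hj]
    omega
  · have h₀ := hp.dist_getVert h.connected' hij hi
    rw [interval_comm] at hw
    rw [Γ'.dist_comm] at hab
    obtain ⟨m, h₁, h₂, h₃⟩ := h.near_path (dist_getVert_succ_le p) k j i hij (by omega) w hw
    refine ⟨p.getVert m, p.getVert_mem_support m, ?_, h₃⟩
    have h₄ := hp.dist_getVert h.connected' h₁ (by omega)
    have h₅ := hp.dist_getVert h.connected' h₂ hi
    rw [Γ'.dist_comm] at h₀ h₄ h₅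
    omega

theorem IsGuess.near_segment (h : IsGuess Γ Γ' δ D) {k : ℕ} {a b w : V}
    (hab : Γ'.dist a b ≤ 2 ^ k) (hw : w ∈ interval Γ a b) :
    ∃ m, Γ'.dist a m + Γ'.dist m b = Γ'.dist a b ∧ Γ'.dist w m ≤ δ * k + D := by
  obtain ⟨p, hp⟩ := h.connected'.exists_walk_length_eq_dist a b
  obtain ⟨m, -, hm⟩ := h.near_geodesic_segment (isGeodesic_of_length_eq hp) p.start_mem_support
    p.end_mem_support hab hw
  exact ⟨m, hm⟩

/-- Discrete intermediate value argument: along a Γ-geodesic towards `w`, the Γ'-distance to `w`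
changes by at most 1 per edge and ends at 0. -/
theorem IsGuess.exists_dist_eq (h : IsGuess Γ Γ' δ D) {R : ℕ} (w : V) (n : ℕ) :
    ∀ x, Γ.dist x w = n → R ≤ Γ'.dist x w → ∃ x' ∈ interval Γ x w, Γ'.dist x' w = R := by
  induction n with
  | zero =>
    intro x hx hR
    refine ⟨x, left_mem_interval, ?_⟩
    have := h.dist_le x w
    omega
  | succ n ih =>
    intro x hx hR
    rcases hR.eq_or_lt with hR | hR
    · exact ⟨x, left_mem_interval, hR.symm⟩
    have hne : x ≠ w := by rintro rfl; simp at hx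
    obtain ⟨z, hz₁, hz₂⟩ := exists_adj_mem_interval h.connected hne
    have h₁ := h.dist_le x z
    have h₂ := h.connected'.dist_triangle (u := x) (v := z) (w := w)
    obtain ⟨x', hx', h₃⟩ := ih z (by omega) (by omega)
    refine ⟨x', ?_, h₃⟩
    rw [mem_interval] at hx' ⊢
    have h₄ := h.connected.dist_triangle (u := x) (v := z) (w := x')
    have h₅ := h.connected.dist_triangle (u := x) (v := x') (w := w)
    omega

/-- If the interval from `x ∈ A` to `w` lies in the `r`-neighborhood of `A`, it contains a point
`x'` which is `r`-close to `A` and at distance `2 * r` from `w`, unless `x'` can be taken in `A`. -/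
theorem IsGuess.exists_anchor (h : IsGuess Γ Γ' δ D) {A : Set V} {x w : V} {r : ℕ} (hx : x ∈ A)
    (hr : ∀ v ∈ interval Γ x w, ∃ a ∈ A, Γ'.dist v a ≤ r) :
    ∃ x' ∈ interval Γ x w, ∃ a ∈ A, Γ'.dist x' w ≤ 2 * r ∧ Γ'.dist x' a ≤ r ∧
      (x' = a ∨ Γ'.dist x' w = 2 * r) := by
  rcases le_total (Γ'.dist x w) (2 * r) with hs | hs
  · exact ⟨x, left_mem_interval, x, hx, hs, by simp, Or.inl rfl⟩
  · obtain ⟨x', hx', hd⟩ := h.exists_dist_eq w _ x rfl hs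
    obtain ⟨a, ha, hxa⟩ := hr x' hx'
    exact ⟨x', hx', a, ha, hd.le, hxa, Or.inr hd⟩

theorem mem_interval_of_mem_interval (hc : Γ.Connected) {x y w x' y' : V}
    (hw : w ∈ interval Γ x y) (hx : x' ∈ interval Γ x w) (hy : y' ∈ interval Γ y w) :
    w ∈ interval Γ x' y' := by
  rw [mem_interval] at *
  have h₁ := hc.dist_triangle (u := x) (v := x') (w := y)
  have h₂ := hc.dist_triangle (u := x') (v := y') (w := y)
  have h₃ := hc.dist_triangle (u := x') (v := w) (w := y')
  have h₄ := Γ.dist_comm (u := y) (v := w)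
  have h₅ := Γ.dist_comm (u := y') (v := w)
  have h₆ := Γ.dist_comm (u := y) (v := y')
  omega

theorem interval_subset_left (hc : Γ.Connected) {x y w : V} (hw : w ∈ interval Γ x y) :
    interval Γ x w ⊆ interval Γ x y := by
  intro v hv
  rw [mem_interval] at *
  have h₁ := hc.dist_triangle (u := x) (v := v) (w := y)
  have h₂ := hc.dist_triangle (u := v) (v := w) (w := y)
  omega

/-- Cut out the part of the interval around `w` between two anchors `x'`, `y'` with partners `a`,
`b` on `p`. In the quadrilateral `x'`, `a`, `b`, `y'`, the point `w` is 2δ-close to one of the other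
three sides. The side from `a` to `b` has Γ'-length at most 6(r + 1), so it stays logarithmically
close to `p`. A side from an anchor to its partner has Γ'-length at most r + 1 and starts at
distance 2(r + 1) from `w`, hence is too far away, unless it degenerates to a point of `p`. -/
theorem IsGuess.descent (h : IsGuess Γ Γ' δ D) {x y : V} {p : Γ'.Walk x y} (hp : IsGeodesic Γ' p)
    {r k : ℕ} (hk : 6 * (r + 1) ≤ 2 ^ k) (hr : 2 * δ + (δ * k + D) < r + 1)
    (hnear : ∀ w ∈ interval Γ x y, ∃ a ∈ p.support, Γ'.dist w a ≤ r + 1) :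
    ∀ w ∈ interval Γ x y, ∃ a ∈ p.support, Γ'.dist w a ≤ r := by
  intro w hw
  by_contra! hfar
  have hw' : w ∈ interval Γ y x := by rwa [interval_comm]
  obtain ⟨x', hx', a, ha, hxw, hxa, hxor⟩ := h.exists_anchor (A := {a | a ∈ p.support})
    (r := r + 1) (w := w) p.start_mem_support
    fun v hv => hnear v (interval_subset_left h.connected hw hv)
  obtain ⟨y', hy', b, hb, hyw, hyb, hyor⟩ := h.exists_anchor (A := {a | a ∈ p.support})
    (r := r + 1) (w := w) p.end_mem_support
    fun v hv => hnear v (by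
      rw [interval_comm]; exact interval_subset_left h.connected hw' hv)
  have hww := mem_interval_of_mem_interval h.connected hw hx' hy'
  have tri := fun u v w => h.connected'.dist_triangle (u := u) (v := v) (w := w)
  have comm := fun u v => Γ'.dist_comm (u := u) (v := v)
  -- points of the interval near a short connecting segment
  have side : ∀ {c e u : V}, e ∈ p.support → (c = e ∨ Γ'.dist c w = 2 * (r + 1)) →
      Γ'.dist c e ≤ r + 1 → u ∈ interval Γ c e → Γ'.dist w u ≤ 2 * δ → False := by
    intro c e u he hor hce hu hwu
    obtain ⟨m, hm, hum⟩ := h.near_segment (k := k) (by omega) hu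
    have h₁ := tri w u m
    rcases hor with rfl | hor
    · have h₂ : Γ'.dist c m = 0 := by
        have := Γ'.dist_self (v := c)
        omega
      have h₃ := hfar c he
      have h₄ := tri w m c
      have h₅ := comm m c
      omega
    · have h₂ := tri c m w
      have h₃ := comm m w
      omega
  obtain ⟨u, hu, hwu⟩ := h.thin _ _ a w hww
  have hwu' := (h.dist_le w u).trans hwu
  rcases hu with hu | hu
  · obtain ⟨v, hv, huv⟩ := h.thin _ _ b u hu
    have huv' := (h.dist_le u v).trans huv
    have h₁ := tri w u v
    rcases hv with hv | hv
    · have h₂ := tri a x' b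
      have h₃ := tri x' w b
      have h₄ := tri w y' b
      have h₅ := comm a x'
      have h₆ := comm w y'
      obtain ⟨m, hm, -, hvm⟩ := h.near_geodesic_segment hp (k := k) ha hb (by omega) hv
      have h₇ := hfar m hm
      have h₈ := tri w v m
      omega
    · rw [interval_comm] at hv
      exact side hb hyor hyb hv (by omega)
  · rw [interval_comm] at hu
    exact side ha hxor hxa hu (by omega)

theorem IsGuess.interval_near_geodesic (h : IsGuess Γ Γ' δ D) :
    ∃ r₀, ∀ (x y : V) (p : Γ'.Walk x y), IsGeodesic Γ' p →
      ∀ w ∈ interval Γ x y, ∃ a ∈ p.support, Γ'.dist w a ≤ r₀ := by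
  obtain ⟨N, hN⟩ := exists_linear_lt_two_pow δ (2 * δ + D + δ * 4)
  refine ⟨2 ^ N, fun x y p hp => ?_⟩
  have key : ∀ r, (∀ w ∈ interval Γ x y, ∃ a ∈ p.support, Γ'.dist w a ≤ 2 ^ N + r) →
      ∀ w ∈ interval Γ x y, ∃ a ∈ p.support, Γ'.dist w a ≤ 2 ^ N := by
    intro r
    induction r with
    | zero => exact fun H => H
    | succ r ih =>
      intro H
      -- With n the logarithm, 2^n ≤ 2^N + r + 1 < 2^(n+1): the summand 4 absorbs the factor 6, and
      -- n ≥ N makes the linear bound smaller than 2^n.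
      refine ih (h.descent hp (k := Nat.log 2 (2 ^ N + r + 1) + 4) ?_ ?_ H)
      · have := Nat.lt_pow_succ_log_self one_lt_two (2 ^ N + r + 1)
        rw [pow_succ] at this
        rw [pow_add]
        linarith [Nat.two_pow_pos (Nat.log 2 (2 ^ N + r + 1))]
      · have h₁ : N ≤ Nat.log 2 (2 ^ N + r + 1) :=
          Nat.le_log_of_pow_le one_lt_two (by omega)
        have h₂ := hN _ h₁
        have h₃ := Nat.pow_log_le_self 2 (Nat.succ_ne_zero (2 ^ N + r))
        rw [mul_add]
        linarith
  -- The descent starts from a crude radius depending on `x` and `y`; the final radius does not.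
  refine key (Γ.dist x y) fun w hw => ⟨x, p.start_mem_support, ?_⟩
  have h₁ := h.dist_le w x
  have h₂ := Γ.dist_comm (u := w) (v := x)
  rw [mem_interval] at hw
  exact le_add_left (by omega)

/-- Connectedness argument: along a Γ-geodesic `q`, nearby points of `p` must pass from before `a`
to after it. At the crossing, `a` lies between two points of `p` at distance at most 2r₀ + 1, the
first of which is r₀-close to `q`. -/
theorem IsGuess.geodesic_near_interval (h : IsGuess Γ Γ' δ D) :
    ∃ r₁, ∀ (x y : V) (p : Γ'.Walk x y), IsGeodesic Γ' p →
      ∀ a ∈ p.support, ∃ w ∈ interval Γ x y, Γ'.dist a w ≤ r₁ := by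
  obtain ⟨r₀, hr₀⟩ := h.interval_near_geodesic
  refine ⟨3 * r₀ + 1, fun x y p hp a ha => ?_⟩
  obtain ⟨i, rfl, hi⟩ := SimpleGraph.Walk.mem_support_iff_exists_getVert.1 ha
  obtain ⟨q, hq⟩ := h.connected.exists_walk_length_eq_dist x y
  have hqg := isGeodesic_of_length_eq hq
  have hmem : ∀ n, q.getVert n ∈ interval Γ x y :=
    fun n => hqg.mem_interval h.connected (q.getVert_mem_support n)
  -- the last vertex of `q` which is close to a vertex of `p` before `p.getVert i`
  let P : ℕ → Prop := fun n => ∃ j ≤ i, Γ'.dist (q.getVert n) (p.getVert j) ≤ r₀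
  have hP₀ : P 0 := ⟨0, Nat.zero_le i, by simp⟩
  have tri := fun u v w => h.connected'.dist_triangle (u := u) (v := v) (w := w)
  have comm := fun u v => Γ'.dist_comm (u := u) (v := v)
  have hcase : P q.length ∨ ∃ n, P n ∧ ¬ P (n + 1) := by
    by_contra! hcon
    exact hcon.1 (Nat.rec hP₀ (fun n hn => hcon.2 n hn) q.length)
  rcases hcase with ⟨j, hj, hd⟩ | ⟨n, ⟨j, hj, hd⟩, hn⟩
  · refine ⟨y, right_mem_interval, ?_⟩
    rw [q.getVert_length] at hd
    have h₁ := hp.dist_getVert h.connected' hi le_rfl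
    have h₂ := hp.dist_getVert h.connected' (hj.trans hi) le_rfl
    rw [p.getVert_length] at h₁ h₂
    have h₃ := comm y (p.getVert j)
    omega
  · refine ⟨q.getVert n, hmem n, ?_⟩
    obtain ⟨b, hb, hbd⟩ := hr₀ x y p hp _ (hmem (n + 1))
    obtain ⟨l, rfl, hl⟩ := SimpleGraph.Walk.mem_support_iff_exists_getVert.1 hb
    have hil : i ≤ l := by
      by_contra! hli
      exact hn ⟨l, hli.le, hbd⟩
    have h₁ := hp.dist_getVert h.connected' (hj.trans hil) hl
    have h₂ := hp.dist_getVert h.connected' hj hi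
    have h₃ := (h.dist_le _ _).trans (dist_getVert_succ_le q n)
    have h₄ := tri (p.getVert j) (q.getVert n) (p.getVert l)
    have h₅ := tri (q.getVert n) (q.getVert (n + 1)) (p.getVert l)
    have h₆ := tri (p.getVert i) (p.getVert j) (q.getVert n)
    have h₇ := comm (p.getVert i) (p.getVert j)
    have h₈ := comm (p.getVert j) (q.getVert n)
    omega

theorem IsGuess.isHyperbolic (h : IsGuess Γ Γ' δ D) : IsHyperbolic Γ' := by
  obtain ⟨r₀, hr₀⟩ := h.interval_near_geodesic
  obtain ⟨r₁, hr₁⟩ := h.geodesic_near_interval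
  refine ⟨h.connected', r₁ + δ + r₀, fun x y z p q r hp hq hr a ha => ?_⟩
  simp only [edist_le_coe_iff h.connected']
  obtain ⟨w, hw, haw⟩ := hr₁ x y p hp a ha
  obtain ⟨u, hu, hwu⟩ := h.thin x y z w hw
  have hwu' := (h.dist_le w u).trans hwu
  have h₁ := h.connected'.dist_triangle (u := a) (v := w) (w := u)
  rcases hu with hu | hu
  · obtain ⟨b, hb, hub⟩ := hr₀ y z q hq u hu
    have h₂ := h.connected'.dist_triangle (u := a) (v := u) (w := b)
    exact ⟨b, Or.inl hb, by omega⟩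
  · obtain ⟨b, hb, hub⟩ := hr₀ z x r hr u hu
    have h₂ := h.connected'.dist_triangle (u := a) (v := u) (w := b)
    exact ⟨b, Or.inr hb, by omega⟩

end Guessing

/-! ### Nearest point projections to quasi-convex sets -/

section Projection

variable {V : Type*} {Γ : SimpleGraph V} {A : Set V} {x y a b p q : V} {δ σ : ℕ}

/-- `a` is a point of `A` nearest to `x`. -/
def IsNearest (Γ : SimpleGraph V) (A : Set V) (x a : V) : Prop :=
  a ∈ A ∧ ∀ b ∈ A, Γ.dist x a ≤ Γ.dist x b

theorem exists_isNearest (Γ : SimpleGraph V) (hA : A.Nonempty) (x : V) :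
    ∃ a, IsNearest Γ A x a := by
  obtain ⟨a, ha, h⟩ := exists_minimalFor_of_wellFoundedLT (· ∈ A) (Γ.dist x) hA
  exact ⟨a, ha, fun b hb => (le_total _ _).elim id fun hle => h hb hle⟩

theorem IsNearest.eq_of_mem (hc : Γ.Connected) (h : IsNearest Γ A x a) (hx : x ∈ A) : a = x := by
  have := h.2 x hx
  rw [SimpleGraph.dist_self, Nat.le_zero, hc.dist_eq_zero_iff] at this
  exact this.symm

/-- `A` is `σ`-quasi-convex, formulated with intervals. -/
def IsQuasiConvexWith (Γ : SimpleGraph V) (A : Set V) (σ : ℕ) : Prop :=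
  ∀ s ∈ A, ∀ t ∈ A, ∀ w ∈ interval Γ s t, ∃ b ∈ A, Γ.dist w b ≤ σ

theorem IsQuasiConvex.exists_isQuasiConvexWith (hc : Γ.Connected) (h : IsQuasiConvex Γ A) :
    ∃ σ, IsQuasiConvexWith Γ A σ := by
  obtain ⟨σ, hσ⟩ := h
  refine ⟨σ, fun s hs t ht w hw => ?_⟩
  obtain ⟨p, hp, hwp⟩ := exists_isGeodesic_of_mem_interval hc hw
  obtain ⟨b, hb, hwb⟩ := hσ s hs t ht p hp w hwp
  exact ⟨b, hb, (edist_le_coe_iff hc).1 hwb⟩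

/-- A geodesic from `x` to its projection leaves `A` quickly: a point of `A` within σ of `p` cannot
be nearer to `x` than `a`, so d(q, a) ≤ d(q, p) + σ. -/
theorem IsNearest.dist_le_of_mem_interval (hc : Γ.Connected) (hA : IsQuasiConvexWith Γ A σ)
    (ha : IsNearest Γ A x a) (hb : b ∈ A) (hp : p ∈ interval Γ a b) (hq : q ∈ interval Γ x a) :
    Γ.dist a p ≤ 2 * Γ.dist p q + σ := by
  obtain ⟨c, hcA, hpc⟩ := hA a ha.1 b hb p hp
  have h₁ := ha.2 c hcA
  have h₂ := hc.dist_triangle (u := x) (v := q) (w := c)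
  have h₃ := hc.dist_triangle (u := q) (v := p) (w := c)
  have h₄ := hc.dist_triangle (u := a) (v := q) (w := p)
  have h₅ := Γ.dist_comm (u := q) (v := p)
  have h₆ := Γ.dist_comm (u := q) (v := a)
  rw [mem_interval] at hq
  omega

/-- A geodesic joining two points with distant projections to `A` passes close to the
projections. -/
theorem IsNearest.exists_mem_interval (hc : Γ.Connected) (hδ : IsThin Γ δ)
    (hA : IsQuasiConvexWith Γ A σ) (ha : IsNearest Γ A x a) (hb : IsNearest Γ A y b)
    (hab : 2 * (4 * δ + σ + 1) ≤ Γ.dist a b) :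
    ∃ q ∈ interval Γ x y, Γ.dist a q ≤ 6 * δ + σ + 1 := by
  obtain ⟨g, hg⟩ := hc.exists_walk_length_eq_dist a b
  have hgg := isGeodesic_of_length_eq hg
  -- This `p` is just too far from `a` and `b` to be 2δ-close to the sides from `x` to `a` or from
  -- `y` to `b`, where the distance would be at most 2(2δ) + σ. Thinness of the quadrilateral leaves
  -- only the side from `x` to `y`.
  set p := g.getVert (4 * δ + σ + 1) with hpdef
  have hp : p ∈ interval Γ a b := hgg.mem_interval hc (g.getVert_mem_support _)
  have hap : Γ.dist a p = 4 * δ + σ + 1 := by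
    have := hgg.dist_getVert hc (Nat.zero_le (4 * δ + σ + 1)) (by omega)
    rwa [g.getVert_zero] at this
  have hpb : p ∈ interval Γ b a := by rwa [interval_comm]
  have hbp : 4 * δ + σ + 1 ≤ Γ.dist b p := by
    rw [mem_interval] at hp
    have := Γ.dist_comm (u := b) (v := p)
    omega
  obtain ⟨q, hq, hpq⟩ := hδ a b y p hp
  rcases hq with hq | hq
  · rw [interval_comm] at hq
    have := hb.dist_le_of_mem_interval hc hA ha.1 hpb hq
    omega
  · obtain ⟨q', hq', hqq'⟩ := hδ y a x q hq
    have h₁ := hc.dist_triangle (u := p) (v := q) (w := q')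
    rcases hq' with hq' | hq'
    · rw [interval_comm] at hq'
      have := ha.dist_le_of_mem_interval hc hA hb.1 hp hq'
      omega
    · refine ⟨q', hq', ?_⟩
      have := hc.dist_triangle (u := a) (v := p) (w := q')
      omega

theorem IsNearest.dist_le_of_dist_le_one (hc : Γ.Connected) (hδ : IsThin Γ δ)
    (hA : IsQuasiConvexWith Γ A σ) (ha : IsNearest Γ A x a) (hb : IsNearest Γ A y b)
    (hxy : Γ.dist x y ≤ 1) : Γ.dist a b ≤ 12 * δ + 2 * σ + 5 := by
  by_contra! hlt
  obtain ⟨q, hq, haq⟩ := ha.exists_mem_interval hc hδ hA hb (by omega)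
  obtain ⟨q', hq', hbq'⟩ := hb.exists_mem_interval hc hδ hA ha (by rw [Γ.dist_comm]; omega)
  rw [mem_interval] at hq hq'
  have h₁ := hc.dist_triangle (u := a) (v := q) (w := b)
  have h₂ := hc.dist_triangle (u := q) (v := y) (w := b)
  have h₃ := hc.dist_triangle (u := y) (v := q') (w := b)
  have h₄ := Γ.dist_comm (u := q') (v := b)
  have h₅ := Γ.dist_comm (u := y) (v := x)
  omega

theorem IsNearest.exists_mem_dist_le (hc : Γ.Connected) (hδ : IsThin Γ δ)
    (hA : IsQuasiConvexWith Γ A σ) {B : Set V} (hB : IsQuasiConvexWith Γ B σ)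
    (ha : IsNearest Γ A x a) (hb : IsNearest Γ A y b) (hx : x ∈ B) (hy : y ∈ B)
    (hab : 2 * (4 * δ + σ + 1) ≤ Γ.dist a b) :
    ∃ c ∈ B, Γ.dist a c ≤ 6 * δ + 2 * σ + 1 := by
  obtain ⟨q, hq, haq⟩ := ha.exists_mem_interval hc hδ hA hb hab
  obtain ⟨c, hcB, hqc⟩ := hB x hx y hy q hq
  have := hc.dist_triangle (u := a) (v := q) (w := c)
  exact ⟨c, hcB, by omega⟩

end Projection

/-! ### Word metrics -/

section Word

variable {G : Type*} [Group G] {S : Set G}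

theorem edist_mulCayley_le_one {g h : G} (hs : g⁻¹ * h ∈ S ∨ h⁻¹ * g ∈ S) :
    (SimpleGraph.mulCayley S).edist g h ≤ 1 := by
  rw [SimpleGraph.edist_le_one_iff_adj_or_eq]
  by_cases hgh : g = h
  · exact Or.inr hgh
  · left
    rw [SimpleGraph.mulCayley_adj']
    rcases hs with hs | hs
    · exact ⟨hgh, _, hs, Or.inl (by group)⟩
    · exact ⟨hgh, _, hs, Or.inr (by group)⟩

theorem dist_mulCayley_le_one (hc : (SimpleGraph.mulCayley S).Connected) {g h : G}
    (hs : g⁻¹ * h ∈ S ∨ h⁻¹ * g ∈ S) : (SimpleGraph.mulCayley S).dist g h ≤ 1 :=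
  (edist_le_coe_iff hc).1 (by exact_mod_cast edist_mulCayley_le_one hs)

theorem mulCayley_adj_iff {g h : G} :
    (SimpleGraph.mulCayley S).Adj g h ↔ g ≠ h ∧ (g⁻¹ * h ∈ S ∨ h⁻¹ * g ∈ S) := by
  rw [SimpleGraph.mulCayley_adj']
  refine and_congr_right fun _ => ⟨?_, ?_⟩
  · rintro ⟨s, hs, rfl | rfl⟩
    · left; simpa
    · right; simpa
  · rintro (hs | hs)
    · exact ⟨_, hs, Or.inl (by group)⟩
    · exact ⟨_, hs, Or.inr (by group)⟩

theorem dist_mulCayley_mul_left (hc : (SimpleGraph.mulCayley S).Connected) (g a b : G) :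
    (SimpleGraph.mulCayley S).dist (g * a) (g * b) = (SimpleGraph.mulCayley S).dist a b := by
  have key : ∀ g a b : G, (SimpleGraph.mulCayley S).dist (g * a) (g * b) ≤
      (SimpleGraph.mulCayley S).dist a b := by
    intro g a b
    obtain ⟨p, hp⟩ := hc.exists_walk_length_eq_dist a b
    let f : SimpleGraph.mulCayley S →g SimpleGraph.mulCayley S :=
      ⟨(g * ·), fun h => SimpleGraph.mulCayley_adj_mul_iff_right.2 h⟩
    have := SimpleGraph.dist_le (p.map f)
    rwa [SimpleGraph.Walk.length_map, hp] at this
  refine le_antisymm (key g a b) ?_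
  simpa using key g⁻¹ (g * a) (g * b)

theorem finite_ball_mulCayley (hS : S.Finite) (n : ℕ) :
    ∀ g : G, {h | (SimpleGraph.mulCayley S).edist g h ≤ (n : ℕ∞)}.Finite := by
  induction n with
  | zero => intro g; simp [SimpleGraph.edist_eq_zero_iff]
  | succ n ih =>
    intro g
    have hf : ({g} ∪ ⋃ s ∈ S ∪ S⁻¹,
        {h | (SimpleGraph.mulCayley S).edist (g * s) h ≤ (n : ℕ∞)}).Finite :=
      (Set.finite_singleton g).union ((hS.union hS.inv).biUnion fun s _ => ih _)
    refine hf.subset fun h hh => ?_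
    obtain ⟨p, hp⟩ := SimpleGraph.exists_walk_of_edist_ne_top
      (ne_top_of_le_ne_top (ENat.natCast_ne_top _) hh)
    have hlen : p.length ≤ n + 1 := by
      have h' : (p.length : ℕ∞) ≤ ((n + 1 : ℕ) : ℕ∞) := hp ▸ hh
      exact_mod_cast h'
    clear hp hh
    cases p with
    | nil => exact Or.inl rfl
    | @cons _ v _ hadj p =>
      right
      simp only [Set.mem_iUnion]
      refine ⟨g⁻¹ * v, ?_, ?_⟩
      · rcases (mulCayley_adj_iff.1 hadj).2 with hs | hs
        · exact Or.inl hs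
        · exact Or.inr (by simpa using hs)
      · rw [SimpleGraph.Walk.length_cons] at hlen
        rw [Set.mem_ofPred_eq, mul_inv_cancel_left]
        exact (SimpleGraph.edist_le p).trans (by exact_mod_cast Nat.le_of_succ_le_succ hlen)

end Word

/-! ### Cosets of the peripheral subgroups, projections of admissible paths, and comparison of the
metrics. -/

section Relative

variable {G : Type*} [Group G] {Λ : Type*} {X : Set G} {H : Λ → Subgroup G}

theorem subset_relGenerators : X ⊆ relGenerators X H :=
  fun x hx => ⟨Sum.inl ⟨x, hx⟩, rfl⟩

theorem mem_relGenerators_of_mem {i : Λ} {h : G} (hh : h ∈ H i) : h ∈ relGenerators X H :=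
  ⟨Sum.inr ⟨i, h, hh⟩, rfl⟩

theorem mulCayley_le_relCayley : SimpleGraph.mulCayley X ≤ relCayley X H :=
  SimpleGraph.mulCayley_mono subset_relGenerators

/-- Left cosets of the subgroups `H i` are `σ`-quasi-convex. -/
theorem exists_isQuasiConvexWith_cosets [Finite Λ] (hc : (SimpleGraph.mulCayley X).Connected)
    (hqc : ∀ i, IsQuasiConvex (SimpleGraph.mulCayley X) (H i : Set G)) :
    ∃ σ, ∀ i g, IsQuasiConvexWith (SimpleGraph.mulCayley X) {a | g⁻¹ * a ∈ H i} σ := by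
  choose f hf using fun i => (hqc i).exists_isQuasiConvexWith hc
  obtain ⟨σ, hσ⟩ := Finite.exists_le f
  refine ⟨σ, fun i g s hs t ht w hw => ?_⟩
  have hinv := dist_mulCayley_mul_left hc
  have hw' : g⁻¹ * w ∈ interval (SimpleGraph.mulCayley X) (g⁻¹ * s) (g⁻¹ * t) := by
    rw [mem_interval, hinv, hinv, hinv]
    exact hw
  obtain ⟨b, hb, hwb⟩ := hf i _ hs _ ht _ hw'
  refine ⟨g * b, by simpa using hb, ?_⟩
  rw [← hinv g⁻¹, inv_mul_cancel_left]
  exact hwb.trans (hσ i)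

theorem isHyperbolic_relCayley [Finite Λ]
    (hhyp : IsHyperbolic (SimpleGraph.mulCayley X))
    (hqc : ∀ i, IsQuasiConvex (SimpleGraph.mulCayley X) (H i : Set G)) :
    IsHyperbolic (relCayley X H) := by
  obtain ⟨δ, hδ⟩ := hhyp.exists_isThin
  have hc := hhyp.1
  have hc' : (relCayley X H).Connected := hc.mono mulCayley_le_relCayley
  obtain ⟨σ, hσ⟩ := exists_isQuasiConvexWith_cosets hc hqc
  have hle : ∀ x y, (relCayley X H).dist x y ≤ (SimpleGraph.mulCayley X).dist x y :=
    fun x y => (hc x y).dist_anti mulCayley_le_relCayley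
  refine IsGuess.isHyperbolic (δ := δ) (D := σ + 1) ⟨hc, hc', hle, hδ, fun x y hxy w hw => ?_⟩
  have comm := (SimpleGraph.mulCayley X).dist_comm (u := x) (v := w)
  have hcase : (SimpleGraph.mulCayley X).dist x y ≤ 1 ∨ ∃ i, x⁻¹ * y ∈ H i := by
    have h₁ : (relCayley X H).edist x y ≤ 1 := by
      exact_mod_cast (edist_le_coe_iff hc' (n := 1)).2 hxy
    rcases SimpleGraph.edist_le_one_iff_adj_or_eq.1 h₁ with h | rfl
    · rcases (mulCayley_adj_iff.1 h).2 with ⟨⟨s, hs⟩ | ⟨i, s, hs⟩, h₂⟩ | ⟨⟨s, hs⟩ | ⟨i, s, hs⟩, h₂⟩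
      · exact Or.inl (dist_mulCayley_le_one hc (Or.inl (h₂ ▸ hs)))
      · exact Or.inr ⟨i, h₂ ▸ hs⟩
      · exact Or.inl (dist_mulCayley_le_one hc (Or.inr (h₂ ▸ hs)))
      · refine Or.inr ⟨i, ?_⟩
        have h₃ : y⁻¹ * x ∈ H i := h₂ ▸ hs
        simpa using (H i).inv_mem h₃
    · exact Or.inl (by simp)
  rcases hcase with h | ⟨i, hi⟩
  · have := hle w x
    rw [mem_interval] at hw
    omega
  · obtain ⟨b, hb, hwb⟩ := hσ i x x (by simp) y hi w hw
    have h₁ := hle w b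
    have h₂ : (relCayley X H).dist b x ≤ 1 :=
      dist_mulCayley_le_one hc' (Or.inr (mem_relGenerators_of_mem hb))
    have h₃ := hc'.dist_triangle (u := w) (v := b) (w := x)
    omega

/-- Nearest point projections to `H j` of other cosets of the peripheral subgroups are uniformly
bounded. -/
theorem exists_dist_nearest_le_of_coset (hc : (SimpleGraph.mulCayley X).Connected) {δ σ : ℕ}
    (hδ : IsThin (SimpleGraph.mulCayley X) δ)
    (hσ : ∀ i g, IsQuasiConvexWith (SimpleGraph.mulCayley X) {a | g⁻¹ * a ∈ H i} σ)
    (hsep : GeometricallySeparated (wordDist X) H) :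
    ∃ C, ∀ (i j : Λ) (x y a b : G), ¬ (i = j ∧ x ∈ H i) → x⁻¹ * y ∈ H i →
      IsNearest (SimpleGraph.mulCayley X) (H j) x a →
      IsNearest (SimpleGraph.mulCayley X) (H j) y b →
        (SimpleGraph.mulCayley X).dist a b ≤ C := by
  -- The orbits of 1 are the subgroups themselves, and ε is the constant of
  -- `IsNearest.exists_mem_dist_le` with `B` the coset xH_i.
  obtain ⟨R, -, hR⟩ := hsep (6 * δ + 2 * σ + 1) (1 : G)
  refine ⟨max R (2 * (4 * δ + σ + 1)), fun i j x y a b hne hxy ha hb => ?_⟩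
  by_contra! hlt
  obtain ⟨hlt₁, hlt₂⟩ := max_lt_iff.1 hlt
  have hj : IsQuasiConvexWith (SimpleGraph.mulCayley X) (H j : Set G) σ := by
    simpa using hσ j 1
  have hnear : ∀ c d x' y', IsNearest (SimpleGraph.mulCayley X) (H j) x' c →
      IsNearest (SimpleGraph.mulCayley X) (H j) y' d → x⁻¹ * x' ∈ H i → x⁻¹ * y' ∈ H i →
      2 * (4 * δ + σ + 1) ≤ (SimpleGraph.mulCayley X).dist c d →
      c ∈ MulAction.orbit (H j) (1 : G) ∩
        nbhd (wordDist X) (x • MulAction.orbit (H i) (1 : G)) (6 * δ + 2 * σ + 1) := by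
    intro c d x' y' hc' hd hx' hy' hcd
    refine ⟨⟨⟨c, hc'.1⟩, mul_one c⟩, ?_⟩
    obtain ⟨e, he, hce⟩ := hc'.exists_mem_dist_le hc hδ hj (hσ i x) hd hx' hy' hcd
    refine ⟨e, ⟨x⁻¹ * e, ⟨⟨x⁻¹ * e, he⟩, mul_one _⟩, ?_⟩, (edist_le_coe_iff hc).2 hce⟩
    exact mul_inv_cancel_left x e
  refine hne (hR x i j ?_)
  have ha' := hnear a b x y ha hb (by simp) hxy hlt₂.le
  have hb' := hnear b a y x hb ha hxy (by simp) (by rw [SimpleGraph.dist_comm]; exact hlt₂.le)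
  -- Both projections lie in the intersection, so its diameter is at least d(a, b) > R.
  refine le_trans ?_ (le_iSup₂_of_le a ha' (le_iSup₂_of_le b hb' le_rfl))
  rw [wordDist, ← (hc a b).coe_dist_eq_edist]
  exact_mod_cast hlt₁.le

theorem exists_dist_nearest_le_of_step (hc : (SimpleGraph.mulCayley X).Connected) {δ σ : ℕ}
    (hδ : IsThin (SimpleGraph.mulCayley X) δ)
    (hσ : ∀ i g, IsQuasiConvexWith (SimpleGraph.mulCayley X) {a | g⁻¹ * a ∈ H i} σ)
    (hsep : GeometricallySeparated (wordDist X) H) :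
    ∃ C, ∀ (j : Λ) (x : G) (s : Step X H) (a b : G), ¬ EdgeIn j x s →
      IsNearest (SimpleGraph.mulCayley X) (H j) x a →
      IsNearest (SimpleGraph.mulCayley X) (H j) (x * s.toGroup) b →
        (SimpleGraph.mulCayley X).dist a b ≤ C := by
  obtain ⟨C, hC⟩ := exists_dist_nearest_le_of_coset hc hδ hσ hsep
  refine ⟨max C (12 * δ + 2 * σ + 5), fun j x s a b hs ha hb => ?_⟩
  obtain ⟨l | ⟨i, h⟩, e⟩ := s
  · refine le_max_of_le_right (ha.dist_le_of_dist_le_one hc hδ (σ := σ) ?_ hb ?_)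
    · simpa using hσ j 1
    · refine dist_mulCayley_le_one hc ?_
      cases e <;> simp [Step.toGroup, Letter.toGroup]
  · have hmem : Step.toGroup (X := X) (H := H) (Sum.inr ⟨i, h⟩, e) ∈ H i := by
      cases e <;> simp [Step.toGroup, Letter.toGroup]
    refine le_max_of_le_left (hC i j x _ a b ?_ (by simpa using hmem) ha hb)
    rintro ⟨rfl, hx⟩
    exact hs ⟨⟨h, rfl⟩, hx, (H i).mul_mem hx hmem⟩

theorem pathEnd_cons (g : G) (s : Step X H) (w : List (Step X H)) :
    pathEnd g (s :: w) = pathEnd (g * s.toGroup) w := by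
  simp [pathEnd, mul_assoc]

/-- Project an admissible path vertex by vertex: consecutive projections differ by an element of
Ω_i, and the endpoints, lying in H_i, are their own projections. Using C + 1 only ensures
positivity. -/
theorem exists_wordDist_Omega_le_relDist [Finite Λ]
    (hhyp : IsHyperbolic (SimpleGraph.mulCayley X))
    (hqc : ∀ i, IsQuasiConvex (SimpleGraph.mulCayley X) (H i : Set G))
    (hsep : GeometricallySeparated (wordDist X) H) :
    ∃ C, 0 < C ∧ ∀ i (h k : H i), wordDist (Omega X H C i) (h : G) (k : G) ≤ relDist X H i h k := by
  have hc := hhyp.1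
  obtain ⟨δ, hδ⟩ := hhyp.exists_isThin
  obtain ⟨σ, hσ⟩ := exists_isQuasiConvexWith_cosets hc hqc
  obtain ⟨C, hC⟩ := exists_dist_nearest_le_of_step hc hδ hσ hsep
  refine ⟨C + 1, C.succ_pos, fun i h k => ?_⟩
  choose π hπ using
    exists_isNearest (SimpleGraph.mulCayley X) (A := (H i : Set G)) ⟨1, (H i).one_mem⟩
  have key : ∀ (w : List (Step X H)) (g : G), Avoids i g w →
      wordDist (Omega X H (C + 1) i) (π g) (π (pathEnd g w)) ≤ (w.length : ℕ∞) := by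
    intro w
    induction w with
    | nil => intro g _; simp [pathEnd, wordDist]
    | cons s w ih =>
      rintro g ⟨hs, hw⟩
      rw [pathEnd_cons, List.length_cons, Nat.cast_succ, add_comm (w.length : ℕ∞)]
      refine SimpleGraph.edist_triangle.trans (add_le_add ?_ (ih _ hw))
      refine edist_mulCayley_le_one (Or.inl
        ⟨(H i).mul_mem ((H i).inv_mem (hπ g).1) (hπ _).1, ?_⟩)
      rw [wordLength, wordDist, edist_le_coe_iff hc, ← dist_mulCayley_mul_left hc (π g)]
      simpa using (hC i g s _ _ hs (hπ g) (hπ _)).trans C.le_succ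
  refine le_iInf fun w => ?_
  have h₁ := key w.1 h w.2.2
  rwa [w.2.1, (hπ h).eq_of_mem hc h.2, (hπ k).eq_of_mem hc k.2] at h₁

/-- Admissibility depends on labels: a step labelled by `X` is never an edge of Γ(H_i, H_i), even if
both its endpoints lie in H_i. -/
theorem exists_path_of_walk {g h : G} (p : (SimpleGraph.mulCayley X).Walk g h) :
    ∃ w : List (Step X H), w.length = p.length ∧ pathEnd g w = h ∧ ∀ i x, Avoids i x w := by
  induction p with
  | nil => exact ⟨[], rfl, by simp [pathEnd], fun _ _ => trivial⟩
  | @cons g v h hadj p ih =>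
    obtain ⟨w, hw, hend, hav⟩ := ih
    obtain ⟨s, hs, hsl⟩ : ∃ s : Step X H, g * s.toGroup = v ∧ ∀ i x, ¬ EdgeIn i x s := by
      rcases (mulCayley_adj_iff.1 hadj).2 with hx | hx
      · exact ⟨(Sum.inl ⟨_, hx⟩, true), by simp [Step.toGroup, Letter.toGroup],
          fun i x hE => by simp [EdgeIn] at hE⟩
      · exact ⟨(Sum.inl ⟨_, hx⟩, false), by simp [Step.toGroup, Letter.toGroup],
          fun i x hE => by simp [EdgeIn] at hE⟩
    exact ⟨s :: w, by simp [hw], by rw [pathEnd_cons, hs, hend], fun i x => ⟨hsl i x, hav i _⟩⟩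

theorem relDist_le_wordDist (i : Λ) (h k : H i) :
    relDist X H i h k ≤ wordDist X (h : G) (k : G) := by
  refine le_iInf fun p => ?_
  obtain ⟨w, hw, hend, hav⟩ := exists_path_of_walk (H := H) p
  exact (iInf_le _ ⟨w, hend, hav i _⟩).trans (by rw [hw])

theorem wordDist_le_mul_wordDist_Omega (hc : (SimpleGraph.mulCayley X).Connected) (C : ℕ) (i : Λ)
    {g h : G} (p : (SimpleGraph.mulCayley (Omega X H C i)).Walk g h) :
    (SimpleGraph.mulCayley X).dist g h ≤ C * p.length := by
  induction p with
  | nil => simp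
  | @cons g v h hadj p ih =>
    have h₁ : (SimpleGraph.mulCayley X).dist g v ≤ C := by
      rcases (mulCayley_adj_iff.1 hadj).2 with ⟨-, hx⟩ | ⟨-, hx⟩ <;>
        rw [wordLength, wordDist, edist_le_coe_iff hc] at hx
      · rw [← dist_mulCayley_mul_left hc g⁻¹]
        simpa using hx
      · rw [SimpleGraph.dist_comm, ← dist_mulCayley_mul_left hc v⁻¹]
        simpa using hx
    have h₂ := hc.dist_triangle (u := g) (v := v) (w := h)
    rw [SimpleGraph.Walk.length_cons, mul_add]
    omega

theorem relDist_le_mul_wordDist_Omega (hc : (SimpleGraph.mulCayley X).Connected) {C : ℕ}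
    (hC : 0 < C) (i : Λ) (h k : H i) :
    relDist X H i h k ≤ (C : ℕ∞) * wordDist (Omega X H C i) (h : G) (k : G) := by
  by_cases htop : wordDist (Omega X H C i) (h : G) (k : G) = ⊤
  -- Positivity of `C` matters here, since 0 * ⊤ = 0 in `ℕ∞`.
  · rw [htop, ENat.mul_top (by exact_mod_cast hC.ne')]
    exact le_top
  · obtain ⟨p, hp⟩ := SimpleGraph.exists_walk_of_edist_ne_top htop
    rw [wordDist, ← hp]
    refine (relDist_le_wordDist i h k).trans ?_
    rw [wordDist, ← (hc h k).coe_dist_eq_edist]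
    exact_mod_cast wordDist_le_mul_wordDist_Omega hc C i p

theorem biLipschitzEquiv_relDist (hc : (SimpleGraph.mulCayley X).Connected) {C : ℕ} (hC : 0 < C)
    (i : Λ)
    (h : ∀ h k : H i, wordDist (Omega X H C i) (h : G) (k : G) ≤ relDist X H i h k) :
    BiLipschitzEquiv (relDist X H i)
      (fun h k : H i => wordDist (Omega X H C i) (h : G) (k : G)) := by
  have hfin : ∀ a b : H i, relDist X H i a b ≠ ⊤ := fun a b =>
    ne_top_of_le_ne_top (SimpleGraph.edist_ne_top_iff_reachable.2 (hc a b))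
      (relDist_le_wordDist i a b)
  refine ⟨fun a b => ⟨fun _ => ne_top_of_le_ne_top (hfin a b) (h a b), fun _ => hfin a b⟩, C,
    fun a b _ _ => ⟨relDist_le_mul_wordDist_Omega hc hC i a b, (h a b).trans ?_⟩⟩
  exact le_mul_of_one_le_left zero_le (by exact_mod_cast hC)

theorem isLocallyFinite_relDist {C : ℕ} (i : Λ)
    (h : ∀ h k : H i, wordDist (Omega X H C i) (h : G) (k : G) ≤ relDist X H i h k)
    (hlf : IsLocallyFinite (fun h k : H i => wordDist X (h : G) (k : G))) :
    IsLocallyFinite (relDist X H i) := by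
  have hΩ : (Omega X H C i).Finite := by
    refine ((hlf 1 C).image (fun k : H i => (k : G))).subset ?_
    rintro g ⟨hg, hgC⟩
    exact ⟨⟨g, hg⟩, hgC, rfl⟩
  intro a n
  refine ((finite_ball_mulCayley hΩ n (a : G)).preimage
    (f := fun k : H i => (k : G)) Subtype.val_injective.injOn).subset fun b hb => ?_
  exact (h a b).trans hb

end Relative

end HypEmb

theorem mainTheorem11 {G : Type*} [Group G] {Λ : Type*} [Finite Λ]
    (X : Set G) (H : Λ → Subgroup G)
    (hgen : Subgroup.closure X = ⊤)
    (hhyp : HypEmb.IsHyperbolic (SimpleGraph.mulCayley X))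
    (hqc : ∀ i, HypEmb.IsQuasiConvex (SimpleGraph.mulCayley X) (H i : Set G))
    (hsep : HypEmb.GeometricallySeparated (HypEmb.wordDist X) H) :
    HypEmb.IsHyperbolic (HypEmb.relCayley X H) ∧
    (∃ C : ℕ, 0 < C ∧ ∀ i, HypEmb.BiLipschitzEquiv (HypEmb.relDist X H i)
      (fun h k : H i => HypEmb.wordDist (HypEmb.Omega X H C i) (h : G) (k : G))) ∧
    ((∀ i, HypEmb.IsLocallyFinite (fun h k : H i => HypEmb.wordDist X (h : G) (k : G))) →
      HypEmb.HyperbolicallyEmbedded X H) := by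
  have hyp := HypEmb.isHyperbolic_relCayley hhyp hqc
  obtain ⟨C, hC, hle⟩ := HypEmb.exists_wordDist_Omega_le_relDist hhyp hqc hsep
  refine ⟨hyp, ⟨C, hC, fun i => HypEmb.biLipschitzEquiv_relDist hhyp.1 hC i (hle i)⟩,
    fun hlf => ⟨⟨?_, hyp⟩, fun i => HypEmb.isLocallyFinite_relDist i (hle i) (hlf i)⟩⟩
  exact top_le_iff.1 (hgen ▸ Subgroup.closure_mono HypEmb.subset_relGenerators)
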